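/- Let $n$ be a nonnegative integer and $[n]=\{1,\dots,n\}$. An object is a compact subset $T$ of $\mathbb{R}_+^n=[0,\infty)^n$. For nonempty $S\subseteq[n]$ let $|T_S|$ be the $|S|$-dimensional volume of the orthogonal projection $T_S$ of $T$ onto the coordinate subspace spanned by the standard basis vectors $v_i$, $i\in S$. Let the constructible region $\Psi_n\subseteq\mathbb{R}^{2^n-1}$ be the set of all real vectors $\pi=(\pi_S)_{\emptyset\neq S\subseteq[n]}$ for which there is an object $T$ with $\pi_S=\log|T_S|$ for all nonempty $S\subseteq[n]$ (where $\log 0=-\infty$, so that all $|T_S|$ are positive). For finite families $\mathcal{A}=(A_i)_{i=1}^k$ and $\mathcal{B}=(B_j)_{j=1}^m$ of nonempty subsets of $[n]$ (repetitions allowed), say that $\mathcal{A}$ covers $\mathcal{B}$ if (1) $|\{i: e\in A_i\}|=|\{j: e\in B_j\}|$ for every $e\in[n]$, and (2) there is a bijection $f$ from $\{(i,t): 1\le i\le k,\ t\in A_i\}$ to $\{(j,s): 1\le j\le m,\ s\in B_j\}$ such that $f(i,t)=(j,s)$ implies $t=s$ and $A_i\subseteq B_j$. In this case the linear inequality $\sum_{j=1}^m\pi_{B_j}-\sum_{i=1}^k\pi_{A_i}\le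 0$ is called a nonuniform-cover (NC) inequality. Theorem. Let $\alpha_S\in\mathbb{R}$ for each nonempty $S\subseteq[n]$. If $\sum_{\emptyset\ne S\subseteq[n]}\alpha_S\pi_S\le 0$ for every $\pi\in\Psi_n$, then this inequality is an NC inequality, or a finite linear combination of NC inequalities with positive real coefficients; that is, its coefficient vector $(\alpha_S)_S$ is the coefficient vector of an NC inequality or a combination, with positive coefficients, of such vectors. -/

import Mathlib

/-- The index set of a `2^n - 1` dimensional vector: the nonempty subsets of `[n]`. -/
abbrev CoordSubset (n : ℕ) : Type := {S : Finset (Fin n) // S.Nonempty}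

/-- An object: a compact subset of the closed nonnegative orthant of `ℝ^n`. -/
def IsObject {n : ℕ} (T : Set (Fin n → ℝ)) : Prop :=
  IsCompact T ∧ ∀ x ∈ T, ∀ i, 0 ≤ x i

/-- The projection `T_S` of `T` onto the coordinate subspace spanned by the basis vectors `v_i`
with `i ∈ S`, this subspace being written in its coordinates as `ℝ^S`. -/
def coordProj {n : ℕ} (T : Set (Fin n → ℝ)) (S : Finset (Fin n)) : Set (S → ℝ) :=
  (fun (x : Fin n → ℝ) (i : S) => x i) '' T

/-- The log-projection vector `π(T)_S = log |T_S|`, where `|T_S|` is the `|S|`-dimensional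
Lebesgue measure of `T_S`. `ENNReal.log` is the natural logarithm with `log 0 = -∞`. -/
noncomputable def logProjVector {n : ℕ} (T : Set (Fin n → ℝ)) (S : CoordSubset n) : EReal :=
  ENNReal.log (MeasureTheory.volume (coordProj T S.1))

/-- The constructible region `Ψ_n`: the real vectors that are log-projection vectors of objects. -/
def constructibleRegion (n : ℕ) : Set (CoordSubset n → ℝ) :=
  {π | ∃ T : Set (Fin n → ℝ), IsObject T ∧ ∀ S, ((π S : ℝ) : EReal) = logProjVector T S}

/-- The family `A` covers the family `B` (subsets may be repeated in a family): every element
lies in as many members of `A` as of `B`, and there is a bijection from the incidences `(A_i, t)`,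
`t ∈ A_i`, to the incidences `(B_j, s)`, `s ∈ B_j`, such that `(A_i, t) ↦ (B_j, s)` implies
`t = s` and `A_i ⊆ B_j`. -/
def Covers {n k m : ℕ} (A : Fin k → CoordSubset n) (B : Fin m → CoordSubset n) : Prop :=
  (∀ e : Fin n, (Finset.univ.filter fun i => e ∈ (A i).1).card =
    (Finset.univ.filter fun j => e ∈ (B j).1).card) ∧
  ∃ f : (Σ i : Fin k, {t : Fin n // t ∈ (A i).1}) ≃ (Σ j : Fin m, {s : Fin n // s ∈ (B j).1}),
    ∀ p, p.2.1 = (f p).2.1 ∧ (A p.1).1 ⊆ (B (f p).1).1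

/-- The coefficient vector of the linear inequality `∑_j π_{B_j} - ∑_i π_{A_i} ≤ 0`. -/
def coverCoeff {n k m : ℕ} (A : Fin k → CoordSubset n) (B : Fin m → CoordSubset n)
    (S : CoordSubset n) : ℝ :=
  ((Finset.univ.filter fun j => B j = S).card : ℝ) - ((Finset.univ.filter fun i => A i = S).card : ℝ)

/-- `∑_S α_S π_S ≤ 0` is a nonuniform-cover inequality `∑_j π_{B_j} ≤ ∑_i π_{A_i}`,
where `A` covers `B`. -/
def IsNC {n : ℕ} (α : CoordSubset n → ℝ) : Prop :=
  ∃ (k m : ℕ) (A : Fin k → CoordSubset n) (B : Fin m → CoordSubset n),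
    Covers A B ∧ α = coverCoeff A B

/-- `∑_S α_S π_S ≤ 0` is a combination, with positive real coefficients, of finitely many
(and at least one) nonuniform-cover inequalities. -/
def IsPositiveCombinationOfNC {n : ℕ} (α : CoordSubset n → ℝ) : Prop :=
  ∃ (r : ℕ) (c : Fin r → ℝ) (γ : Fin r → CoordSubset n → ℝ),
    0 < r ∧ (∀ l, 0 < c l) ∧ (∀ l, IsNC (γ l)) ∧ ∀ S, α S = ∑ l, c l * γ l S

open Finset MeasureTheory

/-! Test the inequality on unions of boxes with sides `exp (t * b s i)`. As `t` grows, each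
log-projection is `t` times the largest `∑ i ∈ S, b s i` up to a bounded error, so the inequality
holds for these maxima (`sum_mul_max_nonpos`). With one box per nonempty subset this becomes a
linear implication, and Farkas' lemma splits `α` into pieces, one per `S`: `(α S)⁺` copies of `S`
minus a nonnegative weighting that covers each element of `S` with total weight `(α S)⁺` and no
other element (`exists_fractional_covers`). The cover equations have rational coefficients, so real
weightings are combinations of integral ones (`real_solution_induction`). An integral one is an NC
inequality whose covered family repeats `S` (`covers_const`). -/

/-! ### Farkas' lemma and rational cones -/

/-- **Farkas' lemma** over an ordered field: a linear functional that is nonpositive wherever the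
finitely many functionals `a i` are nonpositive is a nonnegative combination of them. -/
theorem exists_nonneg_combination_of_forall_nonpos {F W : Type*} [Field F] [LinearOrder F]
    [IsStrictOrderedRing F] [AddCommGroup W] [Module F W] {ι : Type*} (s : Finset ι)
    (a : ι → W →ₗ[F] F) (b : W →ₗ[F] F)
    (h : ∀ w, (∀ i ∈ s, a i w ≤ 0) → b w ≤ 0) :
    ∃ x : ι → F, (∀ i, 0 ≤ x i) ∧ ∀ w, b w = ∑ i ∈ s, x i * a i w := by
  classical
  induction s using Finset.induction_on generalizing a b with
  | empty =>
    refine ⟨0, fun _ => le_rfl, fun w => ?_⟩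
    have h1 := h w (by simp)
    have h2 := h (-w) (by simp)
    rw [map_neg] at h2
    simp only [sum_empty]
    linarith
  | insert j s hj ih =>
    by_cases hs : ∀ w, (∀ i ∈ s, a i w ≤ 0) → b w ≤ 0
    · obtain ⟨x, hx, hb⟩ := ih a b hs
      refine ⟨fun i => if i = j then 0 else x i, fun i => ?_, fun w => ?_⟩
      · dsimp only
        split_ifs
        exacts [le_rfl, hx i]
      · rw [sum_insert hj, hb]
        simp only [if_true, zero_mul, zero_add]
        refine sum_congr rfl fun i hi => ?_
        rw [if_neg (ne_of_mem_of_not_mem hi hj)]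
    · push Not at hs
      obtain ⟨v, hv, hbv⟩ := hs
      have hjv : 0 < a j v := by
        by_contra hcon
        refine absurd (h v fun i hi => ?_) (not_le.2 hbv)
        rcases mem_insert.1 hi with rfl | hi
        exacts [not_lt.1 hcon, hv i hi]
      let u : W := (a j v)⁻¹ • v
      have hju : a j u = 1 := by simp [u, hjv.ne']
      have hu : ∀ i ∈ s, a i u ≤ 0 := fun i hi => by
        simpa [u] using mul_nonpos_of_nonneg_of_nonpos (inv_nonneg.2 hjv.le) (hv i hi)
      have hbu : 0 < b u := by simpa [u] using mul_pos (inv_pos.2 hjv) hbv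
      -- Projection along `u` onto the kernel of `a j`: on its range the constraint `j` is
      -- automatic.
      let P : W →ₗ[F] W := LinearMap.id - (a j).smulRight u
      have hP : ∀ w, P w = w - a j w • u := fun w => rfl
      obtain ⟨x, hx, hb⟩ := ih (fun i => (a i).comp P) (b.comp P) fun w hw => by
        refine h (P w) fun i hi => ?_
        rcases mem_insert.1 hi with rfl | hi
        · simp [hP, hju]
        · exact hw i hi
      -- The weight of `a j` is forced by evaluating at `u`; it is nonnegative as `b u > 0` and `a i
      -- u ≤ 0`.
      refine ⟨fun i => if i = j then b u - ∑ i ∈ s, x i * a i u else x i, fun i => ?_, fun w => ?_⟩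
      · dsimp only
        split_ifs
        · have := sum_nonpos fun i hi => mul_nonpos_of_nonneg_of_nonpos (hx i) (hu i hi)
          linarith
        · exact hx i
      · have hw := hb w
        simp only [LinearMap.comp_apply, hP, map_sub, map_smul, smul_eq_mul, mul_sub,
          sum_sub_distrib] at hw
        have hs : ∀ β : F, ∑ i ∈ s, (if i = j then β else x i) * a i w = ∑ i ∈ s, x i * a i w :=
          fun β => sum_congr rfl fun i hi => by rw [if_neg (ne_of_mem_of_not_mem hi hj)]
        rw [sum_insert hj, hs]
        beta_reduce
        rw [if_pos rfl]
        have hc : ∑ i ∈ s, x i * (a j w * a i u) = a j w * ∑ i ∈ s, x i * a i u := by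
          rw [mul_sum]
          exact sum_congr rfl fun i _ => by ring
        rw [hc] at hw
        linear_combination hw

/-- Given a nonnegative real solution of a homogeneous rational system that is positive at `i₀`,
there is a natural solution positive at `i₀` whose support lies in that of the real solution. -/
theorem exists_nat_solution_of_real_solution {ι κ : Type*} [Fintype ι] [Fintype κ]
    (M : κ → ι → ℚ) (x : ι → ℝ) (hx : ∀ i, 0 ≤ x i) (hM : ∀ k, ∑ i, (M k i : ℝ) * x i = 0)
    (i₀ : ι) (hi₀ : 0 < x i₀) :
    ∃ q : ι → ℕ, 0 < q i₀ ∧ (∀ i, x i = 0 → q i = 0) ∧ ∀ k, ∑ i, M k i * q i = 0 := by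
  classical
  let f : ι → (κ → ℚ) →ₗ[ℚ] ℚ := fun i => ∑ k, M k i • LinearMap.proj k
  have hf : ∀ i w, f i w = ∑ k, M k i * w k := fun i w => by simp [f]
  -- Farkas over `ℚ` for the columns of `M` in the support of `x`: a violating `w`, paired with `M x
  -- = 0`, would give a negative sum equal to zero.
  obtain ⟨y, hy, hb⟩ := exists_nonneg_combination_of_forall_nonpos
    (univ.filter fun i => 0 < x i) f (-f i₀) fun w hw => by
      by_contra! hcon
      have hneg : f i₀ w < 0 := by simpa using hcon
      have hsum : ∑ i, (f i w : ℝ) * x i = 0 := by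
        simp only [hf, Rat.cast_sum, Rat.cast_mul, sum_mul]
        rw [sum_comm]
        refine sum_eq_zero fun k _ => ?_
        rw [← mul_zero (w k : ℝ), ← hM k, mul_sum]
        exact sum_congr rfl fun i _ => by ring
      refine absurd hsum (ne_of_lt (sum_neg' (fun i _ => ?_) ⟨i₀, mem_univ _, ?_⟩))
      · rcases (hx i).eq_or_lt with h0 | h0
        · simp [← h0]
        · exact mul_nonpos_of_nonpos_of_nonneg (by exact_mod_cast hw i (by simpa using h0)) h0.le
      · exact mul_neg_of_neg_of_pos (by exact_mod_cast hneg) hi₀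
  let z : ι → ℚ := fun i => (if 0 < x i then y i else 0) + if i = i₀ then 1 else 0
  have hz0 : ∀ i, 0 ≤ z i := fun i => by
    refine add_nonneg ?_ ?_ <;> split_ifs <;> first | exact hy i | norm_num
  have hz : ∀ k, ∑ i, M k i * z i = 0 := fun k => by
    have := hb (Pi.single k 1)
    simp only [LinearMap.neg_apply, hf, Pi.single_apply, mul_ite, mul_one, mul_zero, sum_ite_eq',
      mem_univ, if_true, sum_filter] at this
    simp only [z, mul_add, sum_add_distrib, mul_ite, mul_one, mul_zero, sum_ite_eq', mem_univ,
      if_true]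
    rw [neg_eq_iff_add_eq_zero, add_comm] at this
    refine Eq.trans ?_ this
    congr 1
    exact sum_congr rfl fun i _ => by rw [mul_comm]
  let d : ℕ := ∏ i, (z i).den
  have hd : ∀ i, ∃ q : ℕ, (q : ℚ) = d * z i := fun i => by
    refine ⟨(∏ j ∈ univ.erase i, (z j).den) * (z i).num.toNat, ?_⟩
    have h1 : ((z i).num.toNat : ℚ) = (z i).num := by
      exact_mod_cast Int.toNat_of_nonneg (Rat.num_nonneg.2 (hz0 i))
    have h2 : d = (z i).den * ∏ j ∈ univ.erase i, (z j).den :=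
      (mul_prod_erase univ (fun j => (z j).den) (mem_univ i)).symm
    rw [h2]
    push_cast
    rw [h1]
    linear_combination (-(∏ j ∈ univ.erase i, ((z j).den : ℚ))) * Rat.mul_den_eq_num (z i)
  choose q hq using hd
  have hdpos : (0 : ℚ) < d := by exact_mod_cast prod_pos fun i _ => (z i).den_pos
  refine ⟨q, ?_, fun i hi => ?_, fun k => ?_⟩
  · have : (0 : ℚ) < q i₀ := by
      rw [hq]
      refine mul_pos hdpos ?_
      simp only [z, if_true, if_pos hi₀]
      linarith [hy i₀]
    exact_mod_cast this
  · have : (q i : ℚ) = 0 := by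
      have hne : i ≠ i₀ := by
        rintro rfl
        exact hi₀.ne' hi
      rw [hq]
      simp [z, hi, hne]
    exact_mod_cast this
  · simp only [hq]
    rw [← mul_zero (d : ℚ), ← hz k, mul_sum]
    exact sum_congr rfl fun i _ => by ring

/-- A nonnegative real solution of a homogeneous rational system lies in the cone generated by
the natural solutions, stated as an induction principle. -/
theorem real_solution_induction {ι κ : Type*} [Fintype ι] [Fintype κ]
    (M : κ → ι → ℚ) (P : (ι → ℝ) → Prop) (zero : P 0) (add : ∀ x y, P x → P y → P (x + y))
    (smul : ∀ (c : ℝ) (q : ι → ℕ), 0 < c → (∀ k, ∑ i, M k i * q i = 0) → P fun i => c * q i)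
    (x : ι → ℝ) (hx : ∀ i, 0 ≤ x i) (hM : ∀ k, ∑ i, (M k i : ℝ) * x i = 0) : P x := by
  classical
  induction hN : (univ.filter fun i => 0 < x i).card using Nat.strong_induction_on generalizing x with
  | _ N ih =>
    by_cases h0 : ∃ i, 0 < x i
    · obtain ⟨i₀, hi₀⟩ := h0
      obtain ⟨q, hq₀, hqx, hq⟩ := exists_nat_solution_of_real_solution M x hx hM i₀ hi₀
      -- Ratio test: the largest multiple of `q` that keeps `x` nonnegative kills coordinate `j`, so
      -- the support shrinks.
      obtain ⟨j, hj, hmin⟩ := exists_min_image (univ.filter fun i => 0 < q i)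
        (fun i => x i / q i) ⟨i₀, by simpa using hq₀⟩
      have hjq : 0 < q j := by simpa using hj
      have hjx : 0 < x j := (hx j).lt_of_ne fun h => hjq.ne' (hqx j h.symm)
      have hjq' : (0 : ℝ) < q j := by exact_mod_cast hjq
      set c : ℝ := x j / q j with hc
      have hcpos : 0 < c := div_pos hjx hjq'
      let y : ι → ℝ := fun i => x i - c * q i
      have hy : ∀ i, 0 ≤ y i := fun i => by
        rcases Nat.eq_zero_or_pos (q i) with h | h
        · simpa [y, h] using hx i
        · have h' : (0 : ℝ) < q i := by exact_mod_cast h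
          have := (le_div_iff₀ h').1 (hmin i (by simpa using h))
          simpa [y] using this
      have hyj : y j = 0 := by
        simp only [y, hc]
        field_simp
        simp
      have hyP : P y := by
        refine ih _ ?_ y hy (fun k => ?_) rfl
        · rw [← hN]
          refine card_lt_card ⟨fun i hi => ?_, fun hsub => ?_⟩
          · have h1 : 0 < y i := by simpa using hi
            have h2 : (0 : ℝ) ≤ c * q i := by positivity
            have h3 : y i = x i - c * q i := rfl
            simp only [mem_filter, mem_univ, true_and]
            linarith
          · have := hsub (by simpa using hjx)
            simp [hyj] at this
        · have h1 : ∑ i, (M k i : ℝ) * q i = 0 := by exact_mod_cast hq k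
          simp only [y, mul_sub, sum_sub_distrib, hM k]
          rw [sum_congr rfl fun i _ => show (M k i : ℝ) * (c * q i) = c * (M k i * q i) by ring,
            ← mul_sum, h1]
          simp
      have : x = y + fun i => c * q i := by
        ext i
        simp [y]
      rw [this]
      exact add _ _ hyP (smul c q hcpos hq)
    · push Not at h0
      have : x = 0 := funext fun i => le_antisymm (h0 i) (hx i)
      rwa [this]

/-! ### Integral covers and NC inequalities -/

/-- A multiplicity function is realised by a finite family. -/
theorem exists_family_card_filter {σ : Type*} [Fintype σ] (q : σ → ℕ) :
    ∃ (k : ℕ) (A : Fin k → σ), ∀ (p : σ → Prop) [DecidablePred p],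
      (univ.filter fun i => p (A i)).card = ∑ S, if p S then q S else 0 := by
  classical
  let e := Fintype.equivFin (Σ S : σ, Fin (q S))
  refine ⟨_, fun i => (e.symm i).1, fun p _ => ?_⟩
  calc _ = (univ.filter fun y : Σ S : σ, Fin (q S) => p y.1).card := by
        refine card_bij (fun i _ => e.symm i) (by simp) (by simp) fun y hy => ⟨e y, ?_, by simp⟩
        simpa using hy
    _ = _ := by
        rw [card_filter, Fintype.sum_sigma]
        refine sum_congr rfl fun S _ => ?_
        split_ifs <;> simp

/-- A family in which every element of `S` has degree `m` and every other element degree `0` covers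
`m` copies of `S`. -/
theorem covers_const {n k m : ℕ} (A : Fin k → CoordSubset n) (S : CoordSubset n)
    (h : ∀ e, (univ.filter fun i => e ∈ (A i).1).card = if e ∈ S.1 then m else 0) :
    Covers A fun _ : Fin m => S := by
  classical
  have hsub : ∀ i, (A i).1 ⊆ S.1 := fun i e he => by
    by_contra hS
    have := h e
    rw [if_neg hS, card_eq_zero] at this
    exact (this ▸ notMem_empty i) (by simpa using he)
  have hdeg : ∀ e : Fin n, (univ.filter fun i => e ∈ (A i).1).card =
      (univ.filter fun _ : Fin m => e ∈ S.1).card := fun e => by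
    rw [h e]
    split_ifs with he <;> simp [he]
  refine ⟨hdeg, ?_⟩
  have hfib : ∀ {l : ℕ} (C : Fin l → CoordSubset n) (e : Fin n),
      Fintype.card {p : Σ i : Fin l, {t : Fin n // t ∈ (C i).1} // p.2.1 = e} =
        (univ.filter fun i => e ∈ (C i).1).card := fun C e => by
    rw [← Fintype.card_subtype]
    refine Fintype.card_congr
      ⟨fun p => ⟨p.1.1, by simpa only [← p.2] using p.1.2.2⟩, fun i => ⟨⟨i.1, e, i.2⟩, rfl⟩, ?_, fun _ => rfl⟩
    rintro ⟨⟨i, t, ht⟩, rfl⟩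
    rfl
  let gA : (Σ i : Fin k, {t : Fin n // t ∈ (A i).1}) → Fin n := fun p => p.2.1
  let gB : (Σ _ : Fin m, {t : Fin n // t ∈ S.1}) → Fin n := fun p => p.2.1
  -- Containment in `S` is automatic, so any bijections between the incidence fibres over each `e`
  -- can be glued.
  let E : ∀ e, {p // gA p = e} ≃ {p // gB p = e} := fun e =>
    Fintype.equivOfCardEq ((hfib A e).trans ((hdeg e).trans (hfib (fun _ : Fin m => S) e).symm))
  exact ⟨Equiv.ofFiberEquiv E, fun p => ⟨(Equiv.ofFiberEquiv_map E p).symm, hsub p.1⟩⟩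

/-- An integral fractional-cover identity `a 1_S = ∑ q_U 1_U` yields a nonuniform-cover
inequality. -/
theorem isNC_of_uniform_cover {n : ℕ} (S : CoordSubset n) (a : ℕ) (q : CoordSubset n → ℕ)
    (h : ∀ e : Fin n, (∑ U : CoordSubset n, if e ∈ U.1 then q U else 0) =
      if e ∈ S.1 then a else 0) :
    IsNC fun U : CoordSubset n => (if U = S then (a : ℝ) else 0) - q U := by
  classical
  obtain ⟨k, A, hA⟩ := exists_family_card_filter q
  refine ⟨k, a, A, fun _ => S, covers_const A S fun e => ?_, ?_⟩
  · rw [← h e]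
    exact hA (fun U => e ∈ U.1)
  · ext U
    have h1 := hA (fun V => V = U)
    rw [sum_ite_eq' univ U] at h1
    simp only [mem_univ, if_true] at h1
    unfold coverCoeff
    rw [h1]
    by_cases hU : U = S
    · simp [hU]
    · simp [hU, Ne.symm hU]

theorem IsNC.isPositiveCombination {n : ℕ} {α : CoordSubset n → ℝ} (h : IsNC α) {c : ℝ}
    (hc : 0 < c) : IsPositiveCombinationOfNC fun S => c * α S :=
  ⟨1, fun _ => c, fun _ => α, one_pos, fun _ => hc, fun _ => h, fun S => by simp⟩

theorem isPositiveCombinationOfNC_zero {n : ℕ} :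
    IsPositiveCombinationOfNC (0 : CoordSubset n → ℝ) := by
  -- At least one term is required, so the empty family covering itself is used.
  have h : IsNC (0 : CoordSubset n → ℝ) :=
    ⟨0, 0, Fin.elim0, Fin.elim0, ⟨fun _ => by simp, Equiv.equivOfIsEmpty _ _, fun p => p.1.elim0⟩,
      by ext; simp [coverCoeff]⟩
  simpa using! h.isPositiveCombination one_pos

theorem IsPositiveCombinationOfNC.add {n : ℕ} {α β : CoordSubset n → ℝ}
    (hα : IsPositiveCombinationOfNC α) (hβ : IsPositiveCombinationOfNC β) :
    IsPositiveCombinationOfNC (α + β) := by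
  obtain ⟨r, c, γ, hr, hc, hγ, h⟩ := hα
  obtain ⟨r', c', γ', -, hc', hγ', h'⟩ := hβ
  refine ⟨r + r', Fin.append c c', Fin.append γ γ', by omega, fun l => ?_, fun l => ?_, fun S => ?_⟩
  · refine Fin.addCases (fun i => ?_) (fun i => ?_) l <;> simp [hc, hc']
  · refine Fin.addCases (fun i => ?_) (fun i => ?_) l <;> simp [hγ, hγ']
  · simp [Fin.sum_univ_add, h, h']

/-! ### Unions of boxes -/

/-- The union of the boxes with one vertex at the origin and side lengths `exp (t * b s i)`. -/
def boxUnion {σ : Type*} {n : ℕ} (b : σ → Fin n → ℝ) (t : ℝ) : Set (Fin n → ℝ) :=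
  ⋃ s, Set.Icc 0 fun i => Real.exp (t * b s i)

theorem isObject_boxUnion {σ : Type*} [Finite σ] {n : ℕ} (b : σ → Fin n → ℝ) (t : ℝ) :
    IsObject (boxUnion b t) := by
  refine ⟨isCompact_iUnion fun s => isCompact_Icc, fun x hx i => ?_⟩
  obtain ⟨s, hs⟩ := Set.mem_iUnion.1 hx
  exact hs.1 i

theorem coordProj_boxUnion {σ : Type*} {n : ℕ} (b : σ → Fin n → ℝ) (t : ℝ) (S : Finset (Fin n)) :
    coordProj (boxUnion b t) S = ⋃ s, Set.Icc 0 fun i : S => Real.exp (t * b s i) := by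
  classical
  ext y
  simp only [coordProj, boxUnion, Set.mem_image, Set.mem_iUnion]
  constructor
  · rintro ⟨x, ⟨s, hs⟩, rfl⟩
    exact ⟨s, fun i => hs.1 i, fun i => hs.2 i⟩
  · rintro ⟨s, hs⟩
    refine ⟨fun i => if h : i ∈ S then y ⟨i, h⟩ else 0, ⟨s, fun i => ?_, fun i => ?_⟩, ?_⟩
    · dsimp only
      split_ifs with h
      exacts [hs.1 ⟨i, h⟩, le_rfl]
    · dsimp only
      split_ifs with h
      exacts [hs.2 ⟨i, h⟩, (Real.exp_pos _).le]
    · ext i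
      simp

theorem volume_box {n : ℕ} (c : Fin n → ℝ) (t : ℝ) (S : Finset (Fin n)) :
    volume (Set.Icc 0 fun i : S => Real.exp (t * c i)) =
      ENNReal.ofReal (Real.exp (t * ∑ i ∈ S, c i)) := by
  rw [Real.volume_Icc_pi, mul_sum, Real.exp_sum, ← ENNReal.ofReal_prod_of_nonneg
    fun i _ => by simpa using (Real.exp_pos _).le]
  simp only [Pi.zero_apply, sub_zero]
  rw [Finset.prod_coe_sort S fun i => Real.exp (t * c i)]

/-- The log-projection vector of a union of boxes is, up to a bounded error, `t` times the maximum
of the linear functions given by the boxes. -/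
theorem exists_mem_constructibleRegion_near_max {σ : Type*} [Fintype σ] [Nonempty σ] {n : ℕ}
    (b : σ → Fin n → ℝ) (m : CoordSubset n → ℝ) (hle : ∀ S s, ∑ i ∈ S.1, b s i ≤ m S)
    (hex : ∀ S, ∃ s, ∑ i ∈ S.1, b s i = m S) {t : ℝ} (ht : 0 ≤ t) :
    ∃ π ∈ constructibleRegion n, ∀ S, |π S - t * m S| ≤ Real.log (Fintype.card σ) := by
  have hcard : (0 : ℝ) < Fintype.card σ := by exact_mod_cast Fintype.card_pos
  have hlow : ∀ S : CoordSubset n, ENNReal.ofReal (Real.exp (t * m S)) ≤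
      volume (coordProj (boxUnion b t) S.1) := fun S => by
    obtain ⟨s, hs⟩ := hex S
    rw [coordProj_boxUnion, ← hs, ← volume_box]
    exact measure_mono (Set.subset_iUnion_of_subset s subset_rfl)
  have hup : ∀ S : CoordSubset n, volume (coordProj (boxUnion b t) S.1) ≤
      ENNReal.ofReal (Fintype.card σ * Real.exp (t * m S)) := fun S => by
    rw [coordProj_boxUnion]
    refine (measure_iUnion_fintype_le _ _).trans ?_
    calc _ ≤ ∑ _s : σ, ENNReal.ofReal (Real.exp (t * m S)) := by
          refine sum_le_sum fun s _ => ?_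
          rw [volume_box]
          gcongr
          exact hle S s
      _ = _ := by
          rw [sum_const, nsmul_eq_mul, ENNReal.ofReal_mul hcard.le]
          simp
  have htop : ∀ S : CoordSubset n, volume (coordProj (boxUnion b t) S.1) ≠ ⊤ := fun S =>
    ((hup S).trans_lt ENNReal.ofReal_lt_top).ne
  have hlow' : ∀ S : CoordSubset n,
      Real.exp (t * m S) ≤ (volume (coordProj (boxUnion b t) S.1)).toReal := fun S =>
    (ENNReal.ofReal_le_iff_le_toReal (htop S)).1 (hlow S)
  have hup' : ∀ S : CoordSubset n, (volume (coordProj (boxUnion b t) S.1)).toReal ≤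
      Fintype.card σ * Real.exp (t * m S) := fun S =>
    ENNReal.toReal_le_of_le_ofReal (by positivity) (hup S)
  have hpos := fun S => (Real.exp_pos _).trans_le (hlow' S)
  refine ⟨fun S => Real.log (volume (coordProj (boxUnion b t) S.1)).toReal,
    ⟨boxUnion b t, isObject_boxUnion b t, fun S => ?_⟩, fun S => ?_⟩
  · refine (ENNReal.log_pos_real (fun h => ?_) (htop S)).symm
    have := hpos S
    simp [h] at this
  · have h1 := Real.log_le_log (Real.exp_pos _) (hlow' S)
    have h2 := Real.log_le_log (hpos S) (hup' S)
    rw [Real.log_mul hcard.ne' (Real.exp_pos _).ne', Real.log_exp] at h2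
    rw [Real.log_exp] at h1
    rw [abs_le]
    constructor <;> linarith

/-- A homogeneous linear inequality valid on the constructible region is valid for maxima of
linear functions. -/
theorem sum_mul_max_nonpos {σ : Type*} [Fintype σ] [Nonempty σ] {n : ℕ} (α : CoordSubset n → ℝ)
    (h : ∀ π ∈ constructibleRegion n, ∑ S : CoordSubset n, α S * π S ≤ 0)
    (b : σ → Fin n → ℝ) (m : CoordSubset n → ℝ) (hle : ∀ S s, ∑ i ∈ S.1, b s i ≤ m S)
    (hex : ∀ S, ∃ s, ∑ i ∈ S.1, b s i = m S) : ∑ S, α S * m S ≤ 0 := by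
  by_contra! hpos
  set K : ℝ := ∑ S, |α S| * Real.log (Fintype.card σ) with hK
  have hlog : 0 ≤ Real.log (Fintype.card σ) :=
    Real.log_nonneg (by exact_mod_cast (Fintype.card_pos : 0 < Fintype.card σ))
  have hK0 : 0 ≤ K := sum_nonneg fun S _ => mul_nonneg (abs_nonneg _) hlog
  obtain ⟨π, hπ, hnear⟩ := exists_mem_constructibleRegion_near_max b m hle hex
    -- At this scale the main term is `K + 1`, beating the total error `K`.
    (t := (K + 1) / ∑ S, α S * m S) (by positivity)
  set t : ℝ := (K + 1) / ∑ S, α S * m S with ht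
  have h1 : t * ∑ S, α S * m S = K + 1 := div_mul_cancel₀ _ hpos.ne'
  have h2 : t * ∑ S, α S * m S - ∑ S, α S * π S ≤ K := by
    rw [mul_sum, ← sum_sub_distrib, hK]
    refine sum_le_sum fun S _ => ?_
    calc t * (α S * m S) - α S * π S = -(α S * (π S - t * m S)) := by ring
      _ ≤ |α S * (π S - t * m S)| := neg_le_abs _
      _ = |α S| * |π S - t * m S| := abs_mul _ _
      _ ≤ _ := mul_le_mul_of_nonneg_left (hnear S) (abs_nonneg _)
  linarith [h π hπ]

/-! ### Fractional covers and the decomposition -/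

/-- A real fractional-cover identity `a 1_S = ∑ y_U 1_U` yields a positive combination of
nonuniform-cover inequalities. -/
theorem isPositiveCombinationOfNC_of_fractional_cover {n : ℕ} (S : CoordSubset n) (a : ℝ)
    (ha : 0 ≤ a) (y : CoordSubset n → ℝ) (hy : ∀ U, 0 ≤ y U)
    (h : ∀ e : Fin n, (∑ U : CoordSubset n, if e ∈ U.1 then y U else 0) =
      if e ∈ S.1 then a else 0) :
    IsPositiveCombinationOfNC fun U => (if U = S then a else 0) - y U := by
  classical
  refine real_solution_induction
    -- The unknown `none` is the multiplicity `a` of `S`; `some U` is the weight `y U`.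
    (fun (e : Fin n) (o : Option (CoordSubset n)) =>
      o.elim (if e ∈ S.1 then 1 else 0) fun U => -if e ∈ U.1 then 1 else 0)
    (fun x => IsPositiveCombinationOfNC fun U => (if U = S then x none else 0) - x (some U))
    ?_ (fun x z hx hz => ?_) (fun c q hc hq => ?_) (fun o => o.elim a y) (fun o => ?_) fun e => ?_
  · simpa using! isPositiveCombinationOfNC_zero
  · convert hx.add hz using 1
    ext U
    simp only [Pi.add_apply]
    split_ifs <;> ring
  · have hnc := isNC_of_uniform_cover S (q none) (fun U => q (some U)) fun e => by
      have := hq e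
      simp only [Fintype.sum_option, Option.elim, neg_mul, ite_mul, one_mul, zero_mul,
        sum_neg_distrib] at this
      rw [← sub_eq_add_neg, sub_eq_zero] at this
      exact_mod_cast this.symm
    convert hnc.isPositiveCombination hc using 1
    ext U
    split_ifs <;> ring
  · cases o
    exacts [ha, hy _]
  · have := h e
    simp only [Fintype.sum_option, Option.elim]
    push_cast
    simp only [apply_ite (Rat.cast : ℚ → ℝ), Rat.cast_one, Rat.cast_zero, neg_mul, ite_mul, one_mul, zero_mul, sum_neg_distrib]
    rw [this]
    ring

/-- A valid inequality splits into fractional-cover inequalities, one for each subset with a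
positive coefficient. -/
theorem exists_fractional_covers {n : ℕ} [Nonempty (CoordSubset n)] (α : CoordSubset n → ℝ)
    (h : ∀ π ∈ constructibleRegion n, ∑ S : CoordSubset n, α S * π S ≤ 0) :
    ∃ x : CoordSubset n → CoordSubset n → ℝ, (∀ S U, 0 ≤ x S U) ∧
      (∀ S, ∀ e : Fin n, (∑ U : CoordSubset n, if e ∈ U.1 then x S U else 0) =
        if e ∈ S.1 then (α S)⁺ else 0) ∧
      ∀ U, ∑ S, x S U = (α U)⁻ := by
  classical
  -- In `w`, `w.1 S` is the exponent vector of the box indexed by `S`, and the constraints make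
  -- `-w.2 U` an upper bound for the maximum at `U`.
  let f : CoordSubset n × CoordSubset n →
      (CoordSubset n → Fin n → ℝ) × (CoordSubset n → ℝ) →ₗ[ℝ] ℝ := fun p =>
    { toFun := fun w => ∑ i ∈ p.2.1, w.1 p.1 i + w.2 p.2
      map_add' := fun v w => by
        simp only [Prod.fst_add, Prod.snd_add, Pi.add_apply, sum_add_distrib]
        ring
      map_smul' := fun c w => by
        simp only [Prod.smul_fst, Prod.smul_snd, Pi.smul_apply, smul_eq_mul, ← mul_sum,
          RingHom.id_apply]
        ring }
  let g : (CoordSubset n → Fin n → ℝ) × (CoordSubset n → ℝ) →ₗ[ℝ] ℝ :=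
    { toFun := fun w => ∑ S, (α S)⁺ * ∑ i ∈ S.1, w.1 S i + ∑ U, (α U)⁻ * w.2 U
      map_add' := fun v w => by
        simp only [Prod.fst_add, Prod.snd_add, Pi.add_apply, sum_add_distrib, mul_add]
        ring
      map_smul' := fun c w => by
        simp only [Prod.smul_fst, Prod.smul_snd, Pi.smul_apply, smul_eq_mul, ← mul_sum,
          RingHom.id_apply, mul_left_comm _ c]
        ring }
  have hf : ∀ S U w, f (S, U) w = ∑ i ∈ U.1, w.1 S i + w.2 U := fun _ _ _ => rfl
  have hg : ∀ w, g w = ∑ S, (α S)⁺ * ∑ i ∈ S.1, w.1 S i + ∑ U, (α U)⁻ * w.2 U := fun _ => rfl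
  obtain ⟨x, hx, hgx⟩ := exists_nonneg_combination_of_forall_nonpos univ f g fun w hw => by
    choose s hs using fun U : CoordSubset n => exists_max_image univ
      (fun S : CoordSubset n => ∑ i ∈ U.1, w.1 S i) univ_nonempty
    have hmax := sum_mul_max_nonpos α h w.1 (fun U => ∑ i ∈ U.1, w.1 (s U) i)
      (fun U S => (hs U).2 S (mem_univ _)) fun U => ⟨s U, rfl⟩
    rw [hg, ← sum_add_distrib]
    refine (sum_le_sum fun S _ => ?_).trans hmax
    have h1 := mul_le_mul_of_nonneg_left ((hs S).2 S (mem_univ _)) (posPart_nonneg (α S))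
    have h2 := hw (s S, S) (mem_univ _)
    rw [hf] at h2
    have h3 := mul_nonpos_of_nonneg_of_nonpos (negPart_nonneg (α S)) h2
    have h4 := posPart_sub_negPart (α S)
    calc _ ≤ (α S)⁺ * ∑ i ∈ S.1, w.1 (s S) i - (α S)⁻ * ∑ i ∈ S.1, w.1 (s S) i := by linarith
      _ = _ := by rw [← sub_mul, h4]
  refine ⟨fun S U => x (S, U), fun S U => hx _, fun S e => ?_, fun U => ?_⟩
  -- Comparing coefficients of `w.1 S e` gives the cover equations; those of `w.2 U` give the
  -- negative parts.
  · have hw := hgx (Pi.single S (Pi.single e 1), 0)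
    have hsum : ∀ S' U : CoordSubset n,
        (∑ i ∈ U.1, (Pi.single S (Pi.single e 1) : CoordSubset n → Fin n → ℝ) S' i) =
          if S' = S then (if e ∈ U.1 then 1 else 0) else 0 := fun S' U => by
      by_cases hS : S' = S
      · subst hS
        simp [Pi.single_apply]
      · simp [hS]
    simp only [hg, Fintype.sum_prod_type, hf, hsum, Pi.zero_apply, mul_zero, sum_const_zero,
      add_zero, mul_ite, mul_one] at hw
    rw [sum_ite_eq' univ S, sum_comm] at hw
    simpa using hw.symm
  · have hw := hgx (0, Pi.single U 1)
    simp only [hg, Fintype.sum_prod_type, hf, Pi.zero_apply, mul_zero, sum_const_zero, zero_add,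
      Pi.single_apply, mul_ite, mul_one, sum_ite_eq', mem_univ, if_true] at hw
    exact hw.symm

theorem isPositiveCombinationOfNC_sum {n : ℕ} {ι : Type*} (s : Finset ι)
    (γ : ι → CoordSubset n → ℝ) (h : ∀ i ∈ s, IsPositiveCombinationOfNC (γ i)) :
    IsPositiveCombinationOfNC (∑ i ∈ s, γ i) :=
  sum_induction γ _ (fun _ _ => IsPositiveCombinationOfNC.add) isPositiveCombinationOfNC_zero h

theorem theorem2 (n : ℕ) (α : CoordSubset n → ℝ)
    (h : ∀ π ∈ constructibleRegion n, ∑ S : CoordSubset n, α S * π S ≤ 0) :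
    IsNC α ∨ IsPositiveCombinationOfNC α := by
  classical
  right
  -- For `n = 0` there are no boxes to take a maximum over.
  rcases isEmpty_or_nonempty (CoordSubset n) with hn | hn
  · rw [Subsingleton.elim α 0]
    exact isPositiveCombinationOfNC_zero
  · obtain ⟨x, hx, hcover, hneg⟩ := exists_fractional_covers α h
    have hsum := isPositiveCombinationOfNC_sum univ _ fun S _ =>
      isPositiveCombinationOfNC_of_fractional_cover S _ (posPart_nonneg (α S)) (x S) (hx S)
        (hcover S)
    convert hsum using 1
    ext U
    simp only [Finset.sum_apply, sum_sub_distrib, sum_ite_eq, mem_univ, if_true, hneg]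
    exact (posPart_sub_negPart (α U)).symm
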